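/- All topological spaces are Hausdorff. A mapping $f:F\to E$ between topological spaces is called nearly continuous if $f^{-1}(V)\subseteq \operatorname{int}\bigl(\overline{f^{-1}(V)}\bigr)$ for every open $V\subseteq E$, and separating if for all $x,y\in E$ with $x\neq y$ there exist neighborhoods $V_x$ of $x$ and $V_y$ of $y$ in $E$ such that $\overline{f^{-1}(V_x)}\cap f^{-1}(V_y)=\emptyset=f^{-1}(V_x)\cap\overline{f^{-1}(V_y)}$. Let $\mathscr M$ be the class of metrizable spaces. A space $E$ is called a $C(\mathscr M)$-space if every nearly continuous mapping $f:F\to E$ with closed graph in $F\times E$, where $F\in\mathscr M$, is continuous; it is called a $C_s(\mathscr M)$-space if every nearly continuous separating mapping $f:F\to E$, where $F\in\mathscr M$, is continuous. Proposition. Let $E$ be a metrizable $C_s(\mathscr M)$-space. Then $E$ is F-hereditary Baire, that is, every closed subspace of $E$ is a Baire space (countable intersections of dense open subsets are dense). The same is true for every metrizable $C(\mathscr M)$-space. -/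

import Mathlib

open Set Topology

universe u

/-- `f` is nearly continuous: `f⁻¹(V) ⊆ int (cl (f⁻¹(V)))` for every open `V`. -/
def NearlyContinuous {F E : Type*} [TopologicalSpace F] [TopologicalSpace E] (f : F → E) : Prop :=
  ∀ V : Set E, IsOpen V → f ⁻¹' V ⊆ interior (closure (f ⁻¹' V))

/-- The graph of `f` is closed in `F × E`. -/
def HasClosedGraph {F E : Type*} [TopologicalSpace F] [TopologicalSpace E] (f : F → E) : Prop :=
  IsClosed {p : F × E | f p.1 = p.2}

/-- `f` is separating: distinct points `x`, `y` of the target have neighborhoods whose preimages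
are separated sets, i.e. each is disjoint from the closure of the other. -/
def IsSeparatingMap {F E : Type*} [TopologicalSpace F] [TopologicalSpace E] (f : F → E) : Prop :=
  ∀ x y : E, x ≠ y → ∃ Vx ∈ 𝓝 x, ∃ Vy ∈ 𝓝 y,
    closure (f ⁻¹' Vx) ∩ f ⁻¹' Vy = ∅ ∧ f ⁻¹' Vx ∩ closure (f ⁻¹' Vy) = ∅

/-- A class of topological spaces. -/
abbrev SpaceClass : Type (u + 1) := ∀ X : Type u, TopologicalSpace X → Prop

/-- The class of metrizable spaces. -/
def metrizableClass : SpaceClass.{u} := fun X t => @TopologicalSpace.MetrizableSpace X t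

/-- `E` is a `C(K)`-space: `E` is Hausdorff and every nearly continuous map with closed graph from
a Hausdorff space in the class `K` to `E` is continuous. -/
def IsCSpace (K : SpaceClass.{u}) (E : Type u) [TopologicalSpace E] : Prop :=
  T2Space E ∧ ∀ (F : Type u) [tF : TopologicalSpace F] [T2Space F], K F tF →
    ∀ f : F → E, NearlyContinuous f → HasClosedGraph f → Continuous f

/-- `E` is a `C_s(K)`-space: `E` is Hausdorff and every nearly continuous separating map from
a Hausdorff space in the class `K` to `E` is continuous. -/
def IsCsSpace (K : SpaceClass.{u}) (E : Type u) [TopologicalSpace E] : Prop :=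
  T2Space E ∧ ∀ (F : Type u) [tF : TopologicalSpace F] [T2Space F], K F tF →
    ∀ f : F → E, NearlyContinuous f → IsSeparatingMap f → Continuous f

/-- `E` is F-hereditary Baire: every closed subspace of `E` is a Baire space. -/
def IsFHereditaryBaire (E : Type*) [TopologicalSpace E] : Prop :=
  ∀ A : Set E, IsClosed A → BaireSpace A

/-!
Closedness of the graph is weaker than being separating, so only `C_s`-spaces matter. A closed
subspace of `E` that is not Baire contains a closed copy of `D false`, where `D t` is the set of
binary sequences that are eventually equal to `t`: such a copy is obtained from a binary scheme of
closed sets in which turning `true` at stage `n` moves into the `n`-th of a decreasing sequence of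
dense open sets with empty intersection, while staying `false` shrinks to a fixed point.

The sets `D false` and `D true` are disjoint and dense in the Cantor space. Pulling them apart, from
the subspace `D false ∪ D true` to the topological sum `D false ⊕ D true`, is nearly continuous by
density and separating because the reverse map is continuous and injective, but it is not
continuous. Since the sum is again a closed subspace of `D false`, it is a closed subspace of `E`.
-/

open Filter Function PiNat

section NearlyContinuous

variable {F G E X : Type*} [TopologicalSpace F] [TopologicalSpace G] [TopologicalSpace E]
  [TopologicalSpace X]

theorem NearlyContinuous.continuous_comp {f : F → E} {g : E → X} (hf : NearlyContinuous f)
    (hg : Continuous g) : NearlyContinuous (g ∘ f) :=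
  fun _ hV => hf _ (hV.preimage hg)

theorem NearlyContinuous.comp_isOpenMap {f : F → E} {g : G → F} (hf : NearlyContinuous f)
    (hg : IsOpenMap g) (hg' : Continuous g) : NearlyContinuous (f ∘ g) := by
  intro V hV
  rw [preimage_comp, ← hg.preimage_closure_eq_closure_preimage hg',
    ← hg.preimage_interior_eq_interior_preimage hg']
  exact preimage_mono (hf V hV)

theorem isSeparatingMap_of_continuous_comp [T2Space X] {f : F → E} {g : E → X} (hg : Continuous g)
    (hg' : Injective g) (hgf : Continuous (g ∘ f)) : IsSeparatingMap f := by
  intro x y hxy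
  obtain ⟨A, B, hA, hB, hxA, hyB, hAB⟩ := t2_separation (hg'.ne hxy)
  have hdisj : Disjoint ((g ∘ f) ⁻¹' A) ((g ∘ f) ⁻¹' B) := hAB.preimage _
  exact ⟨g ⁻¹' A, (hA.preimage hg).mem_nhds hxA, g ⁻¹' B, (hB.preimage hg).mem_nhds hyB,
    (hdisj.closure_left (hB.preimage hgf)).inter_eq,
    (hdisj.closure_right (hA.preimage hgf)).inter_eq⟩

theorem IsSeparatingMap.comp_continuous {f : F → E} {g : G → F} (hf : IsSeparatingMap f)
    (hg : Continuous g) : IsSeparatingMap (f ∘ g) := by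
  intro x y hxy
  obtain ⟨V, hV, W, hW, hVW, hWV⟩ := hf x y hxy
  refine ⟨V, hV, W, hW, subset_empty_iff.1 ?_, subset_empty_iff.1 ?_⟩
  · exact (inter_subset_inter_left _ (hg.closure_preimage_subset _)).trans
      (preimage_mono (f := g) hVW.subset)
  · exact (inter_subset_inter_right _ (hg.closure_preimage_subset _)).trans
      (preimage_mono (f := g) hWV.subset)

theorem IsSeparatingMap.isClosedEmbedding_comp {f : F → E} {g : E → X} (hf : IsSeparatingMap f)
    (hg : IsClosedEmbedding g) : IsSeparatingMap (g ∘ f) := by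
  have hcompl {z : X} (hz : z ∉ range g) : (range g)ᶜ ∈ 𝓝 z :=
    hg.isClosed_range.isOpen_compl.mem_nhds hz
  have hempty : (g ∘ f) ⁻¹' (range g)ᶜ = ∅ :=
    eq_empty_of_forall_notMem fun x hx => hx (mem_range_self (f x))
  intro x y hxy
  by_cases hx : x ∈ range g
  swap
  · exact ⟨_, hcompl hx, univ, univ_mem, by simp [hempty]⟩
  by_cases hy : y ∈ range g
  swap
  · exact ⟨univ, univ_mem, _, hcompl hy, by simp [hempty]⟩
  obtain ⟨a, rfl⟩ := hx
  obtain ⟨b, rfl⟩ := hy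
  obtain ⟨V, hV, W, hW, hVW, hWV⟩ := hf a b (ne_of_apply_ne g hxy)
  rw [hg.isInducing.nhds_eq_comap] at hV hW
  obtain ⟨V', hV', hVV'⟩ := hV
  obtain ⟨W', hW', hWW'⟩ := hW
  refine ⟨V', hV', W', hW', subset_empty_iff.1 ?_, subset_empty_iff.1 ?_⟩
  · exact (inter_subset_inter (closure_mono (preimage_mono (f := f) hVV'))
      (preimage_mono (f := f) hWW')).trans hVW.subset
  · exact (inter_subset_inter (preimage_mono (f := f) hVV')
      (closure_mono (preimage_mono (f := f) hWW'))).trans hWV.subset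

theorem IsSeparatingMap.hasClosedGraph {f : F → E} (hf : IsSeparatingMap f) :
    HasClosedGraph f := by
  refine isOpen_compl_iff.1 (isOpen_iff_mem_nhds.2 ?_)
  rintro ⟨x, y⟩ hxy
  obtain ⟨V, hV, W, hW, -, hVW⟩ := hf (f x) y hxy
  have hx : x ∉ closure (f ⁻¹' W) :=
    disjoint_left.1 (disjoint_iff_inter_eq_empty.2 hVW) (mem_of_mem_nhds hV : f x ∈ V)
  filter_upwards [prod_mem_nhds (isClosed_closure.isOpen_compl.mem_nhds hx) hW]
  rintro ⟨a, b⟩ ⟨ha, hb⟩ (hab : f a = b)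
  exact ha (subset_closure (hab ▸ hb : f a ∈ W))

end NearlyContinuous

theorem IsCSpace.isCsSpace {K : SpaceClass.{u}} {E : Type u} [TopologicalSpace E]
    (h : IsCSpace K E) : IsCsSpace K E :=
  ⟨h.1, fun F _ _ hF f hf hs => h.2 F hF f hf hs.hasClosedGraph⟩

theorem IsCsSpace.continuous_of_isClosedEmbedding_comp_ulift {K : SpaceClass.{u}} {E : Type u}
    [TopologicalSpace E] (h : IsCsSpace K E) {F Q : Type} [TopologicalSpace F] [T2Space F]
    [TopologicalSpace Q] (hF : K (ULift.{u} F) inferInstance) {f : F → Q} (hf : NearlyContinuous f)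
    (hs : IsSeparatingMap f) {φ : Q → E} (hφ : IsClosedEmbedding φ) : Continuous f := by
  have hlift : Continuous ((φ ∘ f) ∘ (ULift.down : ULift.{u} F → F)) :=
    h.2 _ hF _
      ((hf.continuous_comp hφ.continuous).comp_isOpenMap Homeomorph.ulift.isOpenMap
        continuous_uliftDown)
      ((hs.isClosedEmbedding_comp hφ).comp_continuous continuous_uliftDown)
  exact hφ.isInducing.continuous_iff.2 (hlift.comp continuous_uliftUp)

section DisjointDense

theorem unionEqSigmaOfDisjoint_eq_mk {Z ι : Type*} {D : ι → Set Z}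
    (hD : Pairwise (Disjoint on D)) {x : ⋃ i, D i} {i : ι}
    (hx : x.1 ∈ D i) : unionEqSigmaOfDisjoint hD x = ⟨i, x.1, hx⟩ :=
  ((unionEqSigmaOfDisjoint hD).eq_symm_apply).1 (Subtype.ext rfl)

variable {Z ι : Type*} [TopologicalSpace Z] {D : ι → Set Z}

theorem preimage_val_subset_closure_of_dense {S A W : Set Z} (hA : Dense A) (hAS : A ⊆ S)
    (hW : IsOpen W) : (Subtype.val ⁻¹' W : Set S) ⊆ closure (Subtype.val ⁻¹' (W ∩ A)) := by
  intro x hx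
  rw [closure_subtype, Subtype.image_preimage_coe,
    inter_eq_right.2 (inter_subset_right.trans hAS)]
  exact hA.open_subset_closure_inter hW hx

theorem nearlyContinuous_unionEqSigmaOfDisjoint (hD : Pairwise (Disjoint on D))
    (hdense : ∀ i, Dense (D i)) : NearlyContinuous (unionEqSigmaOfDisjoint hD) := by
  intro V hV x hx
  obtain ⟨i, hi⟩ := mem_iUnion.1 x.2
  rw [mem_preimage, unionEqSigmaOfDisjoint_eq_mk hD hi] at hx
  obtain ⟨W, hW, hWV⟩ := isOpen_induced_iff.1 (isOpen_sigma_iff.1 hV i)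
  have hxW : x.1 ∈ W := (Set.ext_iff.1 hWV ⟨x.1, hi⟩).2 hx
  have hsub : Subtype.val ⁻¹' (W ∩ D i) ⊆ unionEqSigmaOfDisjoint hD ⁻¹' V := by
    rintro y ⟨hyW, hyD⟩
    rw [mem_preimage, unionEqSigmaOfDisjoint_eq_mk hD hyD]
    exact (Set.ext_iff.1 hWV ⟨y.1, hyD⟩).1 hyW
  exact mem_interior.2 ⟨Subtype.val ⁻¹' W,
    (preimage_val_subset_closure_of_dense (hdense i) (subset_iUnion D i) hW).trans
      (closure_mono hsub), hW.preimage continuous_subtype_val, hxW⟩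

theorem isSeparatingMap_unionEqSigmaOfDisjoint [T2Space Z] (hD : Pairwise (Disjoint on D)) :
    IsSeparatingMap (unionEqSigmaOfDisjoint hD) := by
  refine isSeparatingMap_of_continuous_comp (g := fun y : Σ i, D i => y.2.1)
    (continuous_sigma fun _ => continuous_subtype_val)
    (Subtype.val_injective.comp (unionEqSigmaOfDisjoint hD).symm.injective) ?_
  simpa only [comp_def, coe_snd_unionEqSigmaOfDisjoint] using continuous_subtype_val

theorem not_continuous_unionEqSigmaOfDisjoint [Nonempty Z] [Nontrivial ι]
    (hD : Pairwise (Disjoint on D)) (hdense : ∀ i, Dense (D i)) :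
    ¬ Continuous (unionEqSigmaOfDisjoint hD) := by
  intro hcont
  obtain ⟨i, j, hij⟩ := exists_pair_ne ι
  obtain ⟨z, hz⟩ := (hdense j).nonempty
  let x : ⋃ i, D i := ⟨z, mem_iUnion_of_mem j hz⟩
  have hclosed : IsClosed (unionEqSigmaOfDisjoint hD ⁻¹' range (Sigma.mk i)) :=
    isClosed_range_sigmaMk.preimage hcont
  have hsub : Subtype.val ⁻¹' (univ ∩ D i) ⊆
      unionEqSigmaOfDisjoint hD ⁻¹' range (Sigma.mk i) := by
    rintro y ⟨-, hy⟩
    exact ⟨_, (unionEqSigmaOfDisjoint_eq_mk hD hy).symm⟩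
  have hx : x ∈ unionEqSigmaOfDisjoint hD ⁻¹' range (Sigma.mk i) :=
    closure_minimal hsub hclosed
      (preimage_val_subset_closure_of_dense (hdense i) (subset_iUnion D i) isOpen_univ
        (mem_univ x.1))
  obtain ⟨y, hy⟩ := hx
  rw [unionEqSigmaOfDisjoint_eq_mk hD (x := x) hz] at hy
  exact hij (congrArg Sigma.fst hy)

end DisjointDense

section EventuallyEqConst

/-- The set of sequences that are eventually equal to `t`. For `β = Bool` it is a countable dense
subset of the Cantor space, a concrete model of the space of rational numbers. -/
def eventuallyEqConst {β : Type*} (t : β) : Set (ℕ → β) :=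
  {b | ∀ᶠ n in atTop, b n = t}

variable {β : Type*}

theorem pairwise_disjoint_eventuallyEqConst :
    Pairwise (Disjoint on (eventuallyEqConst : β → Set (ℕ → β))) := by
  intro s t hst
  refine disjoint_left.2 fun b hs ht => ?_
  obtain ⟨n, hns, hnt⟩ := (Eventually.and hs ht).exists
  exact hst (hns.symm.trans hnt)

theorem dense_eventuallyEqConst [TopologicalSpace β] (t : β) : Dense (eventuallyEqConst t) := by
  intro b
  refine mem_closure_of_tendsto (f := fun (N n : ℕ) => if n < N then b n else t)
    (b := atTop) (tendsto_pi_nhds.2 fun n => ?_) (Eventually.of_forall fun N => ?_)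
  · refine tendsto_const_nhds.congr' ?_
    filter_upwards [eventually_gt_atTop n] with N hN
    rw [if_pos hN]
  · filter_upwards [eventually_ge_atTop N] with n hn
    rw [if_neg hn.not_gt]

theorem countable_eventuallyEqConst [Countable β] (t : β) : (eventuallyEqConst t).Countable := by
  refine (countable_range fun (l : List β) (n : ℕ) => l.getD n t).mono fun b hb => ?_
  obtain ⟨N, hN⟩ := eventually_atTop.1 hb
  refine ⟨(List.range N).map b, funext fun n => ?_⟩
  rcases lt_or_ge n N with hn | hn
  · simp [List.getD, hn]
  · simp [List.getD, hn, hN n hn]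

/-- Prepends `t` to a sequence that is eventually `t`, complementing the sequence when `t = true`.
These maps glue to a closed embedding of the sum of the two spaces of eventually constant binary
sequences into one of them. -/
def consXor (t : Bool) (b : eventuallyEqConst t) : eventuallyEqConst false :=
  ⟨fun n => n.casesOn t fun k => xor t (b.1 k), by
    obtain ⟨N, hN⟩ := eventually_atTop.1 b.2
    refine eventually_atTop.2 ⟨N + 1, fun n hn => ?_⟩
    obtain ⟨k, rfl⟩ := Nat.exists_eq_add_of_le' (Nat.le_of_add_left_le hn)
    simp [hN k (Nat.le_of_succ_le_succ hn)]⟩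

theorem isClosedEmbedding_consXor (t : Bool) : IsClosedEmbedding (consXor t) := by
  have htail (c : eventuallyEqConst false) :
      (fun n => xor t (c.1 (n + 1))) ∈ eventuallyEqConst t := by
    filter_upwards [(tendsto_add_atTop_nat 1).eventually c.2] with n hn
    rw [hn, Bool.xor_false]
  have hxor : Continuous (xor t) := continuous_of_discreteTopology
  let tail (c : eventuallyEqConst false) : eventuallyEqConst t :=
    ⟨fun n => xor t (c.1 (n + 1)), htail c⟩
  refine LeftInverse.isClosedEmbedding (f := tail) ?_ ?_ ?_
  · exact fun b => Subtype.ext (funext fun n => by simp [tail, consXor])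
  · exact .subtype_mk (continuous_pi fun n =>
      hxor.comp ((continuous_apply (n + 1)).comp continuous_subtype_val)) _
  · refine .subtype_mk (continuous_pi fun n => ?_) _
    cases n with
    | zero => exact continuous_const
    | succ n => exact hxor.comp ((continuous_apply n).comp continuous_subtype_val)

theorem isClosedMap_sigma_of_finite {ι X : Type*} {σ : ι → Type*} [Finite ι] [TopologicalSpace X]
    [∀ i, TopologicalSpace (σ i)] {f : (Σ i, σ i) → X}
    (hf : ∀ i, IsClosedMap fun a => f ⟨i, a⟩) : IsClosedMap f := by
  intro S hS
  have himage : f '' S = ⋃ i, (fun a => f ⟨i, a⟩) '' (Sigma.mk i ⁻¹' S) := by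
    ext; simp [Sigma.exists]
  rw [himage]
  exact isClosed_iUnion_of_finite fun i => hf i _ (isClosed_sigma_iff.1 hS i)

theorem isClosedEmbedding_sigma_consXor :
    IsClosedEmbedding fun x : Σ t : Bool, eventuallyEqConst t => consXor x.1 x.2 := by
  refine .of_continuous_injective_isClosedMap
    (continuous_sigma fun t => (isClosedEmbedding_consXor t).continuous) ?_
    (isClosedMap_sigma_of_finite fun t => (isClosedEmbedding_consXor t).isClosedMap)
  rintro ⟨s, b⟩ ⟨t, c⟩ h
  obtain rfl : s = t := congrFun (congrArg Subtype.val h) 0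
  exact congrArg (Sigma.mk s) ((isClosedEmbedding_consXor s).injective h)

end EventuallyEqConst

section CantorScheme

variable {X : Type*} [TopologicalSpace X]

theorem isClosedMap_of_isClosed_range_graph {C : Type*} [TopologicalSpace C] [CompactSpace C]
    {S : Set C} {φ : S → X} (hφ : IsClosed (range fun s : S => (s.1, φ s))) : IsClosedMap φ := by
  intro T hT
  obtain ⟨T', hT', rfl⟩ := isClosed_induced_iff.1 hT
  have himage : φ '' (Subtype.val ⁻¹' T') =
      Prod.snd '' (range (fun s : S => (s.1, φ s)) ∩ Prod.fst ⁻¹' T') := by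
    rw [← image_preimage_eq_range_inter, image_image]
    rfl
  rw [himage]
  exact isClosedMap_snd_of_compactSpace _ (hφ.inter (hT'.preimage continuous_fst))

theorem eq_of_tendsto_smallSets_nhds [T1Space X] {s : ℕ → Set X} {y z : X}
    (hs : Tendsto s atTop (𝓝 y).smallSets) (hz : ∀ n, z ∈ s n) : z = y := by
  by_contra hzy
  obtain ⟨n, hn⟩ :=
    (tendsto_smallSets_iff.1 hs _ (isOpen_compl_singleton.mem_nhds (Ne.symm hzy))).exists
  exact hn (hz n) rfl

variable {β : Type*} [TopologicalSpace β] [DiscreteTopology β] {A : List β → Set X}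

theorem cylinder_mem_nhds (b : ℕ → β) (n : ℕ) : cylinder b n ∈ 𝓝 b :=
  (isOpen_cylinder (fun _ => β) b n).mem_nhds (self_mem_cylinder b n)

theorem isClosed_setOf_forall_mem_res (hclosed : ∀ l, IsClosed (A l)) :
    IsClosed {p : (ℕ → β) × X | ∀ n, p.2 ∈ A (res p.1 n)} := by
  refine isOpen_compl_iff.1 (isOpen_iff_mem_nhds.2 ?_)
  rintro ⟨b, x⟩ hbx
  obtain ⟨n, hn⟩ := not_forall.1 hbx
  filter_upwards [prod_mem_nhds (cylinder_mem_nhds b n) ((hclosed _).isOpen_compl.mem_nhds hn)]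
  rintro ⟨c, y⟩ ⟨hc, hy⟩ hcy
  rw [cylinder_eq_res] at hc
  exact hy (hc ▸ hcy n)

theorem isClosedEmbedding_inducedMap [Finite β] [T1Space X] (hclosed : ∀ l, IsClosed (A l))
    (hdisj : CantorScheme.Disjoint A)
    (hshrink : ∀ b ∈ (CantorScheme.inducedMap A).1,
      ∃ y, Tendsto (fun n => A (res b n)) atTop (𝓝 y).smallSets) :
    IsClosedEmbedding (CantorScheme.inducedMap A).2 := by
  have hshrink' (b) : Tendsto (fun n => A (res b.1 n)) atTop
      (𝓝 ((CantorScheme.inducedMap A).2 b)).smallSets := by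
    obtain ⟨y, hy⟩ := hshrink b.1 b.2
    rwa [eq_of_tendsto_smallSets_nhds hy (CantorScheme.map_mem b)]
  refine .of_continuous_injective_isClosedMap ?_ hdisj.map_injective
    (isClosedMap_of_isClosed_range_graph ?_)
  · refine continuous_iff_continuousAt.2 fun b V hV => ?_
    obtain ⟨n, hn⟩ := (tendsto_smallSets_iff.1 (hshrink' b) V hV).exists
    have hcylinder : ∀ᶠ c : (CantorScheme.inducedMap A).1 in 𝓝 b, c.1 ∈ cylinder b.1 n :=
      continuous_subtype_val.continuousAt (cylinder_mem_nhds b.1 n)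
    refine mem_map.2 ?_
    filter_upwards [hcylinder] with c hc
    rw [cylinder_eq_res] at hc
    exact hn (hc ▸ CantorScheme.map_mem c n)
  · convert! isClosed_setOf_forall_mem_res hclosed using 1
    ext ⟨b, x⟩
    constructor
    · rintro ⟨c, hc⟩ n
      obtain ⟨rfl, rfl⟩ := Prod.mk.inj hc
      exact CantorScheme.map_mem c n
    · intro hx
      let c : (CantorScheme.inducedMap A).1 := ⟨b, x, mem_iInter.2 hx⟩
      exact ⟨c, congrArg (b, ·) (eq_of_tendsto_smallSets_nhds (hshrink' c) hx).symm⟩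

end CantorScheme

section SplittingScheme

/-- A set together with a point in its interior. -/
structure PointedNhd (X : Type*) [TopologicalSpace X] where
  center : X
  carrier : Set X
  mem_nhds : carrier ∈ 𝓝 center

variable {X : Type*} [TopologicalSpace X]

/-- `q` splits `p` into two disjoint closed pieces: `q false` has the same center as `p` and lies
in `U`, whereas `q true` lies in `O`. -/
structure IsSplitting (U O : Set X) (p : PointedNhd X) (q : Bool → PointedNhd X) : Prop where
  isClosed : ∀ t, IsClosed (q t).carrier
  subset : ∀ t, (q t).carrier ⊆ p.carrier
  disjoint : Disjoint (q false).carrier (q true).carrier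
  center_false : (q false).center = p.center
  subset_of_false : (q false).carrier ⊆ U
  subset_of_true : (q true).carrier ⊆ O

theorem exists_isSplitting [T3Space X] {U O : Set X} {p : PointedNhd X} (hU : U ∈ 𝓝 p.center)
    (hO : IsOpen O) (hd : Dense O) (hp : p.center ∉ O) : ∃ q, IsSplitting U O p q := by
  obtain ⟨y, hyO, hyp⟩ := hd.inter_nhds_nonempty (interior_mem_nhds.2 p.mem_nhds)
  have hyx : p.center ≠ y := fun h => hp (h ▸ hyO)
  obtain ⟨V, W, hV, hW, hVW⟩ := t2_separation_nhds hyx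
  obtain ⟨V', hV', hV'c, hV's⟩ :=
    exists_mem_nhds_isClosed_subset (inter_mem (inter_mem p.mem_nhds hU) hV)
  obtain ⟨W', hW', hW'c, hW's⟩ := exists_mem_nhds_isClosed_subset
    (inter_mem (inter_mem (mem_interior_iff_mem_nhds.1 hyp) (hO.mem_nhds hyO)) hW)
  exact ⟨fun t => bif t then ⟨y, W', hW'⟩ else ⟨p.center, V', hV'⟩, {
    isClosed := Bool.forall_bool.2 ⟨hV'c, hW'c⟩
    subset := Bool.forall_bool.2 ⟨fun _ hz => (hV's hz).1.1, fun _ hz => (hW's hz).1.1⟩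
    disjoint := hVW.mono (fun _ hz => (hV's hz).2) (fun _ hz => (hW's hz).2)
    center_false := rfl
    subset_of_false := fun _ hz => (hV's hz).1.2
    subset_of_true := fun _ hz => (hW's hz).1.2 }⟩

/-- The binary scheme with root `p` whose nodes of depth `n` are split by `q n`. -/
def splittingScheme (q : ℕ → PointedNhd X → Bool → PointedNhd X) (p : PointedNhd X) :
    List Bool → PointedNhd X
  | [] => p
  | t :: l => q l.length (splittingScheme q p l) t

variable {U : X → ℕ → Set X} {O : ℕ → Set X} {q : ℕ → PointedNhd X → Bool → PointedNhd X}
  {p : PointedNhd X}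

theorem isClosed_splittingScheme (hq : ∀ n p, IsSplitting (U p.center n) (O n) p (q n p))
    (hp : IsClosed p.carrier) : ∀ l, IsClosed (splittingScheme q p l).carrier
  | [] => hp
  | t :: _ => (hq _ _).isClosed t

theorem disjoint_splittingScheme (hq : ∀ n p, IsSplitting (U p.center n) (O n) p (q n p)) :
    CantorScheme.Disjoint fun l => (splittingScheme q p l).carrier := by
  rintro l (_ | _) (_ | _) hst
  · exact absurd rfl hst
  · exact (hq _ _).disjoint
  · exact (hq _ _).disjoint.symm
  · exact absurd rfl hst

theorem antitone_splittingScheme_res (hq : ∀ n p, IsSplitting (U p.center n) (O n) p (q n p))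
    (b : ℕ → Bool) : Antitone fun n => (splittingScheme q p (res b n)).carrier :=
  antitone_nat_of_succ_le fun n => (hq _ _).subset (b n)

theorem center_splittingScheme_res (hq : ∀ n p, IsSplitting (U p.center n) (O n) p (q n p))
    {b : ℕ → Bool} {N n : ℕ} (hb : ∀ k ≥ N, b k = false) (hn : N ≤ n) :
    (splittingScheme q p (res b n)).center = (splittingScheme q p (res b N)).center := by
  induction n, hn using Nat.le_induction with
  | base => rfl
  | succ n hn ih =>
    rw [res_succ, hb n hn, splittingScheme, (hq _ _).center_false, ih]

theorem exists_mem_splittingScheme_res_tendsto_smallSets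
    (hU : ∀ x, (𝓝 x).HasAntitoneBasis (U x))
    (hq : ∀ n p, IsSplitting (U p.center n) (O n) p (q n p))
    {b : ℕ → Bool} (hb : b ∈ eventuallyEqConst false) :
    ∃ y, (∀ n, y ∈ (splittingScheme q p (res b n)).carrier) ∧
      Tendsto (fun n => (splittingScheme q p (res b n)).carrier) atTop (𝓝 y).smallSets := by
  obtain ⟨N, hN⟩ := eventually_atTop.1 hb
  set y := (splittingScheme q p (res b N)).center
  have hcenter : ∀ n ≥ N, (splittingScheme q p (res b n)).center = y :=
    fun n hn => center_splittingScheme_res hq hN hn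
  refine ⟨y, fun n => ?_, tendsto_smallSets_iff.2 fun V hV => ?_⟩
  · rw [← hcenter (max n N) (le_max_right n N)]
    exact antitone_splittingScheme_res hq b (le_max_left n N)
      (mem_of_mem_nhds (splittingScheme q p _).mem_nhds)
  · obtain ⟨m, hm⟩ := (hU y).mem_iff.1 hV
    filter_upwards [eventually_ge_atTop (max m N + 1)] with n hn
    have hshrink : (splittingScheme q p (res b (max m N + 1))).carrier ⊆ U y (max m N) := by
      rw [res_succ, hN _ (le_max_right m N), splittingScheme, res_length,
        ← hcenter _ (le_max_right m N)]
      exact (hq _ _).subset_of_false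
    exact (antitone_splittingScheme_res hq b hn).trans
      (hshrink.trans (((hU y).antitone (le_max_left m N)).trans hm))

theorem inducedMap_splittingScheme_domain (hU : ∀ x, (𝓝 x).HasAntitoneBasis (U x))
    (hO : Antitone O) (hO' : ⋂ n, O n = ∅)
    (hq : ∀ n p, IsSplitting (U p.center n) (O n) p (q n p)) :
    (CantorScheme.inducedMap fun l => (splittingScheme q p l).carrier).1 =
      eventuallyEqConst false := by
  ext b
  constructor
  · rintro ⟨x, hx⟩
    rw [mem_iInter] at hx
    by_contra hb
    have hfreq : ∃ᶠ n in atTop, b n = true := by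
      simpa [eventuallyEqConst, Filter.Frequently] using hb
    have hxO : x ∈ ⋂ n, O n := mem_iInter.2 fun n => by
      obtain ⟨m, hnm, hm⟩ := frequently_atTop.1 hfreq n
      have hxm := hx (m + 1)
      rw [res_succ, hm] at hxm
      exact hO (hnm.trans_eq (res_length b m).symm) ((hq _ _).subset_of_true hxm)
    exact notMem_empty x (hO' ▸ hxO)
  · intro hb
    obtain ⟨y, hy, -⟩ := exists_mem_splittingScheme_res_tendsto_smallSets hU hq hb
    exact ⟨y, mem_iInter.2 hy⟩

theorem exists_isClosedEmbedding_eventuallyEqConst [T3Space X] [FirstCountableTopology X]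
    [Nonempty X] (hO : ∀ n, IsOpen (O n)) (hd : ∀ n, Dense (O n)) (hanti : Antitone O)
    (hO' : ⋂ n, O n = ∅) :
    ∃ φ : eventuallyEqConst false → X, IsClosedEmbedding φ := by
  choose U hU using fun x : X => (𝓝 x).exists_antitone_basis
  have hsplit (n : ℕ) (p : PointedNhd X) : ∃ q, IsSplitting (U p.center n) (O n) p q := by
    obtain ⟨k, hk⟩ : ∃ k, p.center ∉ O k := by
      simpa [hO'] using (mem_iInter (x := p.center) (s := O)).not
    obtain ⟨q, hq⟩ := exists_isSplitting ((hU p.center).mem n) (hO (max n k)) (hd (max n k))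
      fun h => hk (hanti (le_max_right n k) h)
    exact ⟨q, { hq with
      subset_of_true := hq.subset_of_true.trans (hanti (le_max_left n k)) }⟩
  choose q hq using hsplit
  obtain ⟨x⟩ := ‹Nonempty X›
  let root : PointedNhd X := ⟨x, univ, univ_mem⟩
  have hdom := inducedMap_splittingScheme_domain (p := root) hU hanti hO' hq
  have hembedding : IsClosedEmbedding
      (CantorScheme.inducedMap fun l => (splittingScheme q root l).carrier).2 := by
    refine isClosedEmbedding_inducedMap (isClosed_splittingScheme hq isClosed_univ)
      (disjoint_splittingScheme hq) fun b hb => ?_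
    exact (exists_mem_splittingScheme_res_tendsto_smallSets hU hq (hdom ▸ hb)).imp
      fun _ h => h.2
  rw [← hdom]
  exact ⟨_, hembedding⟩

end SplittingScheme

section Baire

variable {X : Type*} [TopologicalSpace X]

theorem isOpen_dissipate {f : ℕ → Set X} (hf : ∀ n, IsOpen (f n)) (n : ℕ) :
    IsOpen (dissipate f n) :=
  (finite_Iic n).isOpen_biInter fun i _ => hf i

theorem dense_dissipate {f : ℕ → Set X} (hf : ∀ n, IsOpen (f n)) (hd : ∀ n, Dense (f n)) (n : ℕ) :
    Dense (dissipate f n) := by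
  induction n with
  | zero => simpa only [dissipate_zero_nat] using hd 0
  | succ n ih =>
    rw [dissipate_succ]
    exact ih.inter_of_isOpen_right (hd (n + 1)) (hf (n + 1))

theorem exists_isClosed_antitone_dense_iInter_eq_empty_of_not_baireSpace (h : ¬ BaireSpace X) :
    ∃ C : Set X, IsClosed C ∧ C.Nonempty ∧ ∃ O : ℕ → Set C, (∀ n, IsOpen (O n)) ∧
      (∀ n, Dense (O n)) ∧ Antitone O ∧ ⋂ n, O n = ∅ := by
  obtain ⟨f, hfo, hfd, hf⟩ : ∃ f : ℕ → Set X, (∀ n, IsOpen (f n)) ∧ (∀ n, Dense (f n)) ∧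
      ¬ Dense (⋂ n, f n) := by
    by_contra! hcon
    exact h ⟨hcon⟩
  let V : Set X := (closure (⋂ n, f n))ᶜ
  have hVo : IsOpen V := isClosed_closure.isOpen_compl
  have hVne : V.Nonempty := nonempty_compl.2 fun hV => hf (dense_iff_closure_eq.2 hV)
  refine ⟨closure V, isClosed_closure, hVne.closure,
    fun n => Subtype.val ⁻¹' (V ∩ dissipate f n), fun n => ?_, fun n => ?_, ?_, ?_⟩
  · exact (hVo.inter (isOpen_dissipate hfo n)).preimage continuous_subtype_val
  · rw [Subtype.dense_iff, Subtype.image_preimage_coe,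
      inter_eq_self_of_subset_right (inter_subset_left.trans subset_closure)]
    exact closure_minimal ((dense_dissipate hfo hfd n).open_subset_closure_inter hVo)
      isClosed_closure
  · exact fun _ _ hmn => preimage_mono (inter_subset_inter_right V (antitone_dissipate hmn))
  · rw [← preimage_iInter, ← inter_iInter, iInter_dissipate,
      (disjoint_compl_left.mono_right subset_closure).inter_eq, preimage_empty]

theorem exists_isClosedEmbedding_eventuallyEqConst_of_not_baireSpace [T3Space X]
    [FirstCountableTopology X] (h : ¬ BaireSpace X) :
    ∃ φ : eventuallyEqConst false → X, IsClosedEmbedding φ := by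
  obtain ⟨C, hC, hCne, O, hO, hd, hanti, hO'⟩ :=
    exists_isClosed_antitone_dense_iInter_eq_empty_of_not_baireSpace h
  have : Nonempty C := hCne.to_subtype
  obtain ⟨φ, hφ⟩ := exists_isClosedEmbedding_eventuallyEqConst hO hd hanti hO'
  exact ⟨_, hC.isClosedEmbedding_subtypeVal.comp hφ⟩

end Baire

theorem IsCsSpace.isFHereditaryBaire {K : SpaceClass.{u}}
    (hK : ∀ (F : Type u) [t : TopologicalSpace F] [Countable F]
      [TopologicalSpace.MetrizableSpace F], K F t)
    {E : Type u} [TopologicalSpace E] [FirstCountableTopology E] [RegularSpace E]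
    (h : IsCsSpace K E) : IsFHereditaryBaire E := by
  intro A hA
  by_contra hB
  have : T2Space E := h.1
  obtain ⟨φ, hφ⟩ := exists_isClosedEmbedding_eventuallyEqConst_of_not_baireSpace hB
  have hembedding := (hA.isClosedEmbedding_subtypeVal.comp hφ).comp isClosedEmbedding_sigma_consXor
  have : Countable (⋃ t : Bool, eventuallyEqConst t) :=
    (countable_iUnion countable_eventuallyEqConst).to_subtype
  have hmetrizable := Homeomorph.ulift.{u} (X := ⋃ t : Bool, eventuallyEqConst t)
    |>.isEmbedding.metrizableSpace
  exact not_continuous_unionEqSigmaOfDisjoint pairwise_disjoint_eventuallyEqConst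
    dense_eventuallyEqConst <| h.continuous_of_isClosedEmbedding_comp_ulift (hK _)
      (nearlyContinuous_unionEqSigmaOfDisjoint _ dense_eventuallyEqConst)
      (isSeparatingMap_unionEqSigmaOfDisjoint _) hembedding

theorem mainTheorem12_general {K : SpaceClass.{u}}
    (hK : ∀ (F : Type u) [t : TopologicalSpace F] [Countable F]
      [TopologicalSpace.MetrizableSpace F], K F t)
    (E : Type u) [TopologicalSpace E] [FirstCountableTopology E] [RegularSpace E] :
    (IsCsSpace K E → IsFHereditaryBaire E) ∧ (IsCSpace K E → IsFHereditaryBaire E) :=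
  ⟨fun h => h.isFHereditaryBaire hK, fun h => h.isCsSpace.isFHereditaryBaire hK⟩

theorem mainTheorem12 (E : Type u) [TopologicalSpace E] [TopologicalSpace.MetrizableSpace E] :
    (IsCsSpace metrizableClass.{u} E → IsFHereditaryBaire E) ∧
      (IsCSpace metrizableClass.{u} E → IsFHereditaryBaire E) :=
  mainTheorem12_general (fun _ _ _ hF => hF) E
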